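/- **Proposition (Generalized Crossing Theorem).** Let $I=[-1,1]$, let $n\ge 0$ and $0\le k\le n$ be integers, and define the complementary coordinate sub-cubes of $I^n\subseteq\mathbb{R}^n$ $$I_k=\{x\in\mathbb{R}^n : |x_1|\le 1,\dots,|x_k|\le 1,\ x_{k+1}=\dots=x_n=0\},$$ $$\hat I_{k+1}=\{x\in\mathbb{R}^n : x_1=\dots=x_k=0,\ |x_{k+1}|\le 1,\dots,|x_n|\le 1\}.$$ Let $\partial I_k$ and $\partial\hat I_{k+1}$ denote their relative boundaries, i.e. their boundaries within their affine spans. Let $g:I_k\to I^n$ and $h:\hat I_{k+1}\to I^n$ be continuous maps with $g(s)=s$ for all $s\in\partial I_k$ and $h(t)=t$ for all $t\in\partial\hat I_{k+1}$. Then there exist $s\in I_k$ and $t\in\hat I_{k+1}$ such that $g(s)=h(t)$. In other words, the images $g(I_k)$ and $h(\hat I_{k+1})$ have at least one point in common. -/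

import Mathlib

/-- The cube `Iⁿ = [-1,1]ⁿ` in `ℝⁿ`. -/
def cube (n : ℕ) : Set (Fin n → ℝ) :=
  {x | ∀ i, |x i| ≤ 1}

/-- `I_k = {|x₁| ≤ 1, …, |x_k| ≤ 1, x_{k+1} = 0, …, x_n = 0}`.
The `j`-th coordinate `x_j` (`1 ≤ j ≤ n`) is `x i` with `i : Fin n` of value `j - 1`. -/
def subcube (n k : ℕ) : Set (Fin n → ℝ) :=
  {x | (∀ i : Fin n, (i : ℕ) + 1 ≤ k → |x i| ≤ 1) ∧ ∀ i : Fin n, k < (i : ℕ) + 1 → x i = 0}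

/-- `Î_l = {x₁ = 0, …, x_{l-1} = 0, |x_l| ≤ 1, …, |x_n| ≤ 1}`. -/
def coSubcube (n l : ℕ) : Set (Fin n → ℝ) :=
  {x | (∀ i : Fin n, (i : ℕ) + 1 < l → x i = 0) ∧ ∀ i : Fin n, l ≤ (i : ℕ) + 1 → |x i| ≤ 1}

/-! Composing `g` and `h` with clamping retractions gives maps `u`, `v` from `ℝⁿ` to the cube. On
the faces `x i = ±1`, `u` fixes the `i`-th coordinate for the first `k` indices, and `v` fixes it
for the others. Hence the components of `u - v`, with sign reversed for the last indices, are `≤ 0`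
on the face `x i = -1` and `≥ 0` on `x i = 1`. Poincaré–Miranda (`exists_eq_zero_of_forall_face`)
gives a common zero, where `u = v`. Poincaré–Miranda follows from a cubical Sperner lemma, proved by
a mod 2 Stokes argument: the cup product of the coboundaries of all labels sums to 1 over the grid
(`sum_latticeFace_cupCoboundary`), so it is nonzero on some small cube. -/

section CubicalCochains

/-! ### Mod 2 cubical cochains and Kuhn's lemma. -/

variable {ι : Type*} [DecidableEq ι]

/-- The lattice point following `z` in direction `j`. -/
def latticeStep (z : ι → ℕ) (j : ι) : ι → ℕ := Function.update z j (z j + 1)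

lemma latticeStep_comm (z : ι → ℕ) (j k : ι) :
    latticeStep (latticeStep z j) k = latticeStep (latticeStep z k) j := by
  ext i
  simp only [latticeStep, Function.update_apply]
  split_ifs <;> subst_vars <;> simp_all

/-- The coboundary of a cubical cochain mod 2. A cube is given by its least vertex and its set of
directions. -/
def cubicalCoboundary (w : (ι → ℕ) → Finset ι → ZMod 2) (z : ι → ℕ) (S : Finset ι) : ZMod 2 :=
  ∑ j ∈ S, (w (latticeStep z j) (S.erase j) - w z (S.erase j))

/-- The cup product of the coboundaries of a list of functions on the lattice. -/
def cupCoboundary : List ((ι → ℕ) → ZMod 2) → (ι → ℕ) → Finset ι → ZMod 2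
  | [], _, S => if S = ∅ then 1 else 0
  | a :: l, z, S =>
    ∑ j ∈ S, (a (latticeStep z j) - a z) * cupCoboundary l (latticeStep z j) (S.erase j)

lemma sum_sum_erase_eq_zero (S : Finset ι) (f : ι → ι → ZMod 2) (hf : ∀ j k, f j k = f k j) :
    ∑ j ∈ S, ∑ k ∈ S.erase j, f j k = 0 := by
  rw [Finset.sum_sigma']
  refine Finset.sum_involution (fun p _ => ⟨p.2, p.1⟩) ?_ ?_ ?_ ?_
  · rintro ⟨j, k⟩ _
    rw [hf k j]
    exact CharTwo.add_self_eq_zero _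
  · rintro ⟨j, k⟩ h _ h'
    simp only [Finset.mem_sigma, Finset.mem_erase] at h
    exact h.2.1 (congrArg Sigma.fst h')
  · rintro ⟨j, k⟩ h
    simp only [Finset.mem_sigma, Finset.mem_erase] at h ⊢
    exact ⟨h.2.2, Ne.symm h.2.1, h.1⟩
  · rintro ⟨j, k⟩ _
    rfl

lemma cubicalCoboundary_cubicalCoboundary (w : (ι → ℕ) → Finset ι → ZMod 2) (z : ι → ℕ)
    (S : Finset ι) : cubicalCoboundary (cubicalCoboundary w) z S = 0 := by
  simp only [cubicalCoboundary, ← Finset.sum_sub_distrib]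
  refine sum_sum_erase_eq_zero S _ fun j k => ?_
  rw [latticeStep_comm z j k, Finset.erase_right_comm]
  ring

lemma cubicalCoboundary_mul (a : (ι → ℕ) → ZMod 2) (w : (ι → ℕ) → Finset ι → ZMod 2) (z : ι → ℕ)
    (S : Finset ι) :
    cubicalCoboundary (fun z S => a z * w z S) z S =
      ∑ j ∈ S, (a (latticeStep z j) - a z) * w (latticeStep z j) (S.erase j) +
        a z * cubicalCoboundary w z S := by
  simp only [cubicalCoboundary, Finset.mul_sum, ← Finset.sum_add_distrib]
  refine Finset.sum_congr rfl fun j _ => ?_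
  ring

lemma cupCoboundary_closed (l : List ((ι → ℕ) → ZMod 2)) (z : ι → ℕ) (S : Finset ι) :
    cubicalCoboundary (cupCoboundary l) z S = 0 := by
  induction l generalizing z S with
  | nil => simp [cubicalCoboundary, cupCoboundary]
  | cons a l ih =>
    have : cupCoboundary (a :: l) = cubicalCoboundary (fun z S => a z * cupCoboundary l z S) := by
      ext z S
      rw [cubicalCoboundary_mul, ih, mul_zero, add_zero, cupCoboundary]
    rw [this, cubicalCoboundary_cubicalCoboundary]

/-- Leibniz rule with a closed second factor. Exactness lets sums over a face telescope to its
boundary. -/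
lemma cupCoboundary_cons (a : (ι → ℕ) → ZMod 2) (l : List ((ι → ℕ) → ZMod 2)) (z : ι → ℕ)
    (S : Finset ι) :
    cupCoboundary (a :: l) z S = cubicalCoboundary (fun z S => a z * cupCoboundary l z S) z S := by
  rw [cubicalCoboundary_mul, cupCoboundary_closed, mul_zero, add_zero, cupCoboundary]

/-- The product is a sum over monotone edge paths with directions in `S`. These never leave the
hyperplane `y j = z j`, so the factor from `a` vanishes. -/
lemma cupCoboundary_eq_zero_of_constant {a : (ι → ℕ) → ZMod 2} {l : List ((ι → ℕ) → ZMod 2)}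
    (ha : a ∈ l) {j : ι} {z : ι → ℕ} {S : Finset ι} (hj : j ∉ S) {c : ZMod 2}
    (hc : ∀ y : ι → ℕ, y j = z j → a y = c) : cupCoboundary l z S = 0 := by
  induction l generalizing z S with
  | nil => simp at ha
  | cons b l ih =>
    rw [cupCoboundary]
    refine Finset.sum_eq_zero fun k hk => ?_
    have hz : latticeStep z k j = z j :=
      Function.update_of_ne (fun h : j = k => hj (h ▸ hk)) _ _
    rcases List.mem_cons.1 ha with rfl | ha
    · rw [hc _ hz, hc z rfl, sub_self, zero_mul]
    · rw [ih ha (fun h => hj (Finset.mem_of_mem_erase h)) (by rwa [hz]), mul_zero]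

lemma exists_ne_of_cupCoboundary_ne_zero {l : List ((ι → ℕ) → ZMod 2)} {z : ι → ℕ} {S : Finset ι}
    (h : cupCoboundary l z S ≠ 0) {a : (ι → ℕ) → ZMod 2} (ha : a ∈ l) :
    ∃ p q : ι → ℕ, (∀ i, z i ≤ p i ∧ p i ≤ z i + if i ∈ S then 1 else 0) ∧
      (∀ i, z i ≤ q i ∧ q i ≤ z i + if i ∈ S then 1 else 0) ∧ a p ≠ a q := by
  induction l generalizing z S with
  | nil => simp at ha
  | cons b l ih =>
    rw [cupCoboundary] at h
    obtain ⟨j, hj, hne⟩ := Finset.exists_ne_zero_of_sum_ne_zero h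
    rcases List.mem_cons.1 ha with rfl | ha
    · refine ⟨latticeStep z j, z, fun i => ?_, fun i => by simp,
        sub_ne_zero.1 (left_ne_zero_of_mul hne)⟩
      by_cases hij : i = j
      · subst hij; simp [latticeStep, hj]
      · simp [latticeStep, hij]
    · obtain ⟨p, q, hp, hq, hpq⟩ := ih (right_ne_zero_of_mul hne) ha
      have key : ∀ r : ι → ℕ, (∀ i, latticeStep z j i ≤ r i ∧
          r i ≤ latticeStep z j i + if i ∈ S.erase j then 1 else 0) →
          ∀ i, z i ≤ r i ∧ r i ≤ z i + if i ∈ S then 1 else 0 := by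
        intro r hr i
        have := hr i
        by_cases hij : i = j
        · subst hij
          simp only [latticeStep, Function.update_self, Finset.notMem_erase, if_false] at this
          simp only [hj, if_true]
          omega
        · simpa [latticeStep, hij] using this
      exact ⟨p, q, key p hp, key q hq, hpq⟩

variable [Fintype ι]

/-- The least vertices of the unit cubes with directions `S` in the face of `{0, …, m}^ι` on which
the remaining coordinates are equal to `m`. -/
def latticeFace (m : ℕ) (S : Finset ι) : Finset (ι → ℕ) :=
  Fintype.piFinset fun i => if i ∈ S then Finset.range m else {m}

lemma sum_latticeFace {M : Type*} [AddCommMonoid M] (m : ℕ) {S : Finset ι} {j : ι} (hj : j ∈ S)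
    (f : (ι → ℕ) → M) :
    ∑ z ∈ latticeFace m S, f z =
      ∑ z ∈ latticeFace m (S.erase j), ∑ t ∈ Finset.range m, f (Function.update z j t) := by
  rw [Finset.sum_sigma']
  refine Finset.sum_bij' (fun z _ => ⟨Function.update z j m, z j⟩)
    (fun p _ => Function.update p.1 j p.2) ?_ ?_ ?_ ?_ ?_
  · intro z hz
    simp only [latticeFace, Fintype.mem_piFinset, Finset.mem_sigma] at hz ⊢
    refine ⟨fun i => ?_, by simpa [hj] using hz j⟩
    by_cases hij : i = j
    · subst hij; simp
    · simpa [hij] using hz i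
  · rintro ⟨z, t⟩ hz
    simp only [latticeFace, Fintype.mem_piFinset, Finset.mem_sigma] at hz ⊢
    intro i
    by_cases hij : i = j
    · subst hij; simpa [hj] using hz.2
    · simpa [hij] using hz.1 i
  · intro z _
    simp
  · rintro ⟨z, t⟩ hz
    simp only [latticeFace, Fintype.mem_piFinset, Finset.mem_sigma] at hz
    have := hz.1 j
    simp only [Finset.notMem_erase, if_false, Finset.mem_singleton] at this
    simp [← this]
  · intro z _
    simp

lemma sum_latticeFace_sub {M : Type*} [AddCommGroup M] (m : ℕ) {S : Finset ι} {j : ι} (hj : j ∈ S)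
    (f : (ι → ℕ) → M) :
    ∑ z ∈ latticeFace m S, (f (latticeStep z j) - f z) =
      ∑ z ∈ latticeFace m (S.erase j), (f z - f (Function.update z j 0)) := by
  rw [sum_latticeFace m hj]
  refine Finset.sum_congr rfl fun z hz => ?_
  have hzj : z j = m := by
    simpa using Fintype.mem_piFinset.1 hz j
  have := Finset.sum_range_sub (fun t => f (Function.update z j t)) m
  simp only [latticeStep, Function.update_idem, Function.update_self]
  rw [this, ← hzj, Function.update_eq_self]

/-- Stokes and induction: on the two boundary faces in a direction `j ≠ i`, `a j` is constant and
kills the product. In direction `i` the factor `a i` is 1 on the upper face and 0 on the lower one,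
leaving the sum for `l`. -/
lemma sum_latticeFace_cupCoboundary {m : ℕ} {a : ι → (ι → ℕ) → ZMod 2}
    (h0 : ∀ i z, z i = 0 → a i z = 0) (h1 : ∀ i z, z i = m → a i z = 1) (l : List ι)
    (hl : l.Nodup) :
    ∑ z ∈ latticeFace m l.toFinset, cupCoboundary (l.map a) z l.toFinset = 1 := by
  induction l with
  | nil => simp [latticeFace, cupCoboundary]
  | cons i l ih =>
    obtain ⟨hil, hl'⟩ := List.nodup_cons.1 hl
    set S := (i :: l).toFinset with hS
    have hiS : i ∈ S := by simp [hS]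
    have hSi : S.erase i = l.toFinset := by simp [hS, hil]
    simp only [List.map_cons, cupCoboundary_cons, cubicalCoboundary]
    rw [Finset.sum_comm]
    have key : ∀ j ∈ S, ∑ z ∈ latticeFace m S,
        (a i (latticeStep z j) * cupCoboundary (l.map a) (latticeStep z j) (S.erase j) -
          a i z * cupCoboundary (l.map a) z (S.erase j)) = if j = i then 1 else 0 := by
      intro j hj
      rw [sum_latticeFace_sub m hj (fun z => a i z * cupCoboundary (l.map a) z (S.erase j))]
      have hm : ∀ z ∈ latticeFace m (S.erase j), z j = m := fun z hz => by
        simpa using Fintype.mem_piFinset.1 hz j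
      split_ifs with hji
      · subst hji
        rw [← ih hl', hSi]
        refine Finset.sum_congr rfl fun z hz => ?_
        rw [h1 j z (hm z (hSi ▸ hz)), h0 j _ (Function.update_self ..)]
        ring
      · have hjl : a j ∈ l.map a := by
          refine List.mem_map_of_mem ?_
          simpa [hS, hji] using hj
        refine Finset.sum_eq_zero fun z hz => ?_
        rw [cupCoboundary_eq_zero_of_constant hjl (Finset.notMem_erase j S) (c := 1)
            (fun y hy => h1 j y (hy.trans (hm z hz))),
          cupCoboundary_eq_zero_of_constant hjl (Finset.notMem_erase j S) (c := 0)
            (fun y hy => h0 j y (by simpa using hy))]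
        ring
    rw [Finset.sum_congr rfl key, Finset.sum_ite_eq' S i, if_pos hiS]

/-- Kuhn's cubical form of Sperner's lemma. -/
theorem exists_cube_forall_exists_ne {m : ℕ} {a : ι → (ι → ℕ) → ZMod 2}
    (h0 : ∀ i z, z i = 0 → a i z = 0) (h1 : ∀ i z, z i = m → a i z = 1) :
    ∃ z : ι → ℕ, (∀ i, z i < m) ∧ ∀ i, ∃ p q : ι → ℕ, (∀ j, z j ≤ p j ∧ p j ≤ z j + 1) ∧
      (∀ j, z j ≤ q j ∧ q j ≤ z j + 1) ∧ a i p ≠ a i q := by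
  have hsum := sum_latticeFace_cupCoboundary h0 h1 (Finset.univ : Finset ι).toList
    (Finset.nodup_toList _)
  rw [Finset.toList_toFinset] at hsum
  obtain ⟨z, hz, hne⟩ := Finset.exists_ne_zero_of_sum_ne_zero (hsum.trans_ne one_ne_zero)
  refine ⟨z, fun i => by simpa using Fintype.mem_piFinset.1 hz i, fun i => ?_⟩
  simpa using exists_ne_of_cupCoboundary_ne_zero hne
    (List.mem_map_of_mem (f := a) (Finset.mem_toList.2 (Finset.mem_univ i)))

end CubicalCochains

/-! ### From grid labels to a zero of a continuous map. -/

section PoincareMiranda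

variable {ι : Type*}

/-- The point of `[-1, 1]^ι` with index `z` in the regular grid with `m` steps in each direction. -/
noncomputable def gridPoint (m : ℕ) (z : ι → ℕ) : ι → ℝ := fun i => 2 * (z i / m) - 1

lemma gridPoint_mem {m : ℕ} (hm : 0 < m) {z : ι → ℕ} (hz : ∀ i, z i ≤ m) :
    gridPoint m z ∈ Set.Icc (-1 : ι → ℝ) 1 := by
  have hm' : (0 : ℝ) < m := Nat.cast_pos.2 hm
  refine ⟨fun i => ?_, fun i => ?_⟩
  · have : (0 : ℝ) ≤ z i / m := by positivity
    simp only [gridPoint, Pi.neg_apply, Pi.one_apply]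
    linarith
  · have : (z i / m : ℝ) ≤ 1 := (div_le_one hm').2 (Nat.cast_le.2 (hz i))
    simp only [gridPoint, Pi.one_apply]
    linarith

lemma dist_gridPoint_le [Fintype ι] {m : ℕ} (hm : 0 < m) {z p : ι → ℕ} (hp : ∀ j, z j ≤ p j ∧ p j ≤ z j + 1) :
    dist (gridPoint m p) (gridPoint m z) ≤ 2 / m := by
  have hm' : (0 : ℝ) < m := Nat.cast_pos.2 hm
  refine (dist_pi_le_iff (by positivity)).2 fun i => ?_
  have h1 : (z i : ℝ) ≤ p i := Nat.cast_le.2 (hp i).1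
  have h2 : (p i : ℝ) ≤ z i + 1 := by exact_mod_cast (hp i).2
  have : gridPoint m p i - gridPoint m z i = 2 * (p i - z i) / m := by
    simp only [gridPoint]; ring
  rw [Real.dist_eq, this, abs_of_nonneg (by have := sub_nonneg.2 h1; positivity)]
  gcongr
  linarith

/-- The **Poincaré–Miranda theorem**. -/
theorem exists_eq_zero_of_forall_face [Fintype ι] {G : (ι → ℝ) → ι → ℝ}
    (hG : ContinuousOn G (Set.Icc (-1) 1))
    (hneg : ∀ x ∈ Set.Icc (-1 : ι → ℝ) 1, ∀ i, x i = -1 → G x i ≤ 0)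
    (hpos : ∀ x ∈ Set.Icc (-1 : ι → ℝ) 1, ∀ i, x i = 1 → 0 ≤ G x i) :
    ∃ x ∈ Set.Icc (-1 : ι → ℝ) 1, G x = 0 := by
  classical
  have hK : IsCompact (Set.Icc (-1 : ι → ℝ) 1) := isCompact_Icc
  -- A minimiser of `‖G‖` is a zero as soon as `‖G‖` takes values at most `ε` for every `ε > 0`; no
  -- limit of grid points is needed.
  obtain ⟨x, hx, hmin⟩ := hK.exists_isMinOn
    (Set.nonempty_Icc.2 fun i => by simp) hG.norm
  refine ⟨x, hx, norm_le_zero_iff.1 (le_of_forall_pos_le_add fun ε hε => ?_)⟩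
  rw [zero_add]
  obtain ⟨δ, hδ, hδG⟩ :=
    Metric.uniformContinuousOn_iff.1 (hK.uniformContinuousOn_of_continuous hG) ε hε
  obtain ⟨m, hm2⟩ := exists_nat_gt (2 / δ)
  have hm' : (0 : ℝ) < m := lt_trans (by positivity) hm2
  have hm : 0 < m := Nat.cast_pos.1 hm'
  have hmδ : 2 / (m : ℝ) < δ := by
    rw [div_lt_iff₀ hδ] at hm2
    rwa [div_lt_iff₀ hm', mul_comm]
  -- Labels at `0` and `m` are imposed: `G` may vanish on a face, and the combinatorial lemma wants
  -- exact values even off the grid.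
  let a : ι → (ι → ℕ) → ZMod 2 := fun i z =>
    if z i = 0 then 0 else if z i = m then 1 else if 0 < G (gridPoint m z) i then 1 else 0
  have ha0 : ∀ i z, (∀ j, z j ≤ m) → a i z = 0 → G (gridPoint m z) i ≤ 0 := by
    intro i z hz h
    by_cases h0 : z i = 0
    · exact hneg _ (gridPoint_mem hm hz) i (by simp [gridPoint, h0])
    · by_contra! hlt
      simp [a, h0, hlt] at h
  have ha1 : ∀ i z, (∀ j, z j ≤ m) → a i z ≠ 0 → 0 ≤ G (gridPoint m z) i := by
    intro i z hz h
    by_cases h1 : z i = m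
    · exact hpos _ (gridPoint_mem hm hz) i (by simp [gridPoint, h1, hm'.ne']; norm_num)
    · by_contra! hlt
      simp [a, h1, hlt.not_gt] at h
  obtain ⟨z, hzm, hz⟩ := exists_cube_forall_exists_ne (m := m) (a := a)
    (fun i z h => by simp [a, h]) (fun i z h => by simp [a, h, hm.ne'])
  have hzI := gridPoint_mem hm fun i => (hzm i).le
  refine (hmin hzI).trans ((pi_norm_le_iff_of_nonneg hε.le).2 fun i => ?_)
  have near : ∀ p : ι → ℕ, (∀ j, z j ≤ p j ∧ p j ≤ z j + 1) →
      |G (gridPoint m p) i - G (gridPoint m z) i| < ε := fun p hp =>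
    (dist_le_pi_dist (G (gridPoint m p)) (G (gridPoint m z)) i).trans_lt
      (hδG _ (gridPoint_mem hm fun j => (hp j).2.trans (hzm j)) _ hzI
        ((dist_gridPoint_le hm hp).trans_lt hmδ))
  have key : ∀ p q : ι → ℕ, (∀ j, z j ≤ p j ∧ p j ≤ z j + 1) →
      (∀ j, z j ≤ q j ∧ q j ≤ z j + 1) → a i p = 0 → a i q ≠ 0 →
      ‖G (gridPoint m z) i‖ ≤ ε := by
    intro p q hp hq h0 h1
    have hp0 := ha0 i p (fun j => (hp j).2.trans (hzm j)) h0
    have hq0 := ha1 i q (fun j => (hq j).2.trans (hzm j)) h1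
    have hp1 := abs_lt.1 (near p hp)
    have hq1 := abs_lt.1 (near q hq)
    rw [Real.norm_eq_abs, abs_le]
    constructor <;> linarith
  obtain ⟨p, q, hp, hq, hpq⟩ := hz i
  by_cases h0 : a i p = 0
  · exact key p q hp hq h0 fun h => hpq (h0.trans h.symm)
  · have h2 : ∀ u v : ZMod 2, u ≠ v → u ≠ 0 → v = 0 := by decide
    exact key q p hq hp (h2 _ _ hpq h0) h0

end PoincareMiranda

/-! ### Relative boundaries, retractions and the crossing point. -/

lemma mem_intrinsicFrontier_of_forall_smul_notMem {V : Type*} [NormedAddCommGroup V]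
    [NormedSpace ℝ V] {C : Set V} {s : V} (h0 : (0 : V) ∈ C) (hs : s ∈ C)
    (h : ∀ t : ℝ, 1 < t → t • s ∉ C) : s ∈ intrinsicFrontier ℝ C := by
  rw [← intrinsicClosure_sdiff_intrinsicInterior]
  refine ⟨subset_intrinsicClosure hs, ?_⟩
  rintro ⟨y, hy, rfl⟩
  -- The ray from `0` through `y` stays in the affine span, so a relatively interior `y` could be
  -- pushed slightly outwards within `C`.
  have hmem : ∀ t : ℝ, t • (y : V) ∈ affineSpan ℝ C := fun t => by
    simpa [AffineMap.lineMap_apply] using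
      AffineMap.lineMap_mem t (subset_affineSpan ℝ C h0) (subset_affineSpan ℝ C hs)
  let c : ℝ → affineSpan ℝ C := fun t => ⟨t • (y : V), hmem t⟩
  have hc : Continuous c := by fun_prop
  have hc1 : c 1 = y := Subtype.ext (one_smul ℝ _)
  have hev : ∀ᶠ t in nhds (1 : ℝ), c t ∈ interior ((↑) ⁻¹' C : Set (affineSpan ℝ C)) :=
    hc.continuousAt.eventually_mem (isOpen_interior.mem_nhds (hc1.symm ▸ hy))
  obtain ⟨t, ht, ht1⟩ := ((hev.filter_mono nhdsWithin_le_nhds).and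
    (self_mem_nhdsWithin : Set.Ioi (1 : ℝ) ∈ nhdsWithin 1 (Set.Ioi 1))).exists
  have htC : c t ∈ ((↑) ⁻¹' C : Set (affineSpan ℝ C)) := interior_subset ht
  exact h t ht1 htC

lemma zero_mem_subcube (n k : ℕ) : (0 : Fin n → ℝ) ∈ subcube n k := by simp [subcube]

lemma zero_mem_coSubcube (n l : ℕ) : (0 : Fin n → ℝ) ∈ coSubcube n l := by simp [coSubcube]

lemma one_lt_abs_smul {n : ℕ} {s : Fin n → ℝ} {i : Fin n} (hi : |s i| = 1) {t : ℝ} (ht : 1 < t) :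
    1 < |(t • s) i| := by
  rw [Pi.smul_apply, smul_eq_mul, abs_mul, hi, mul_one, abs_of_pos (by linarith)]
  exact ht

lemma mem_intrinsicFrontier_subcube {n k : ℕ} {s : Fin n → ℝ} (hs : s ∈ subcube n k) {i : Fin n}
    (hik : (i : ℕ) + 1 ≤ k) (hi : |s i| = 1) : s ∈ intrinsicFrontier ℝ (subcube n k) :=
  mem_intrinsicFrontier_of_forall_smul_notMem (zero_mem_subcube n k) hs fun _ ht h =>
    (one_lt_abs_smul hi ht).not_ge (h.1 i hik)

lemma mem_intrinsicFrontier_coSubcube {n l : ℕ} {s : Fin n → ℝ} (hs : s ∈ coSubcube n l)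
    {i : Fin n} (hil : l ≤ (i : ℕ) + 1) (hi : |s i| = 1) :
    s ∈ intrinsicFrontier ℝ (coSubcube n l) :=
  mem_intrinsicFrontier_of_forall_smul_notMem (zero_mem_coSubcube n l) hs fun _ ht h =>
    (one_lt_abs_smul hi ht).not_ge (h.2 i hil)

/-- The retraction of `ℝⁿ` onto `I_k` that clamps the first `k` coordinates. -/
def toSubcube (n k : ℕ) (x : Fin n → ℝ) : subcube n k :=
  ⟨fun i => if (i : ℕ) + 1 ≤ k then max (-1) (min 1 (x i)) else 0,
    fun i hi => by simp [hi, abs_le], fun i hi => if_neg hi.not_ge⟩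

/-- The retraction of `ℝⁿ` onto `Î_l` that clamps the coordinates from the `l`-th on. -/
def toCoSubcube (n l : ℕ) (x : Fin n → ℝ) : coSubcube n l :=
  ⟨fun i => if l ≤ (i : ℕ) + 1 then max (-1) (min 1 (x i)) else 0,
    fun i hi => if_neg hi.not_ge, fun i hi => by simp [hi, abs_le]⟩

lemma continuous_toSubcube (n k : ℕ) : Continuous (toSubcube n k) := by
  refine Continuous.subtype_mk (continuous_pi fun i => ?_) _
  split_ifs <;> fun_prop

lemma continuous_toCoSubcube (n l : ℕ) : Continuous (toCoSubcube n l) := by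
  refine Continuous.subtype_mk (continuous_pi fun i => ?_) _
  split_ifs <;> fun_prop

lemma map_toSubcube_apply {n k : ℕ} {g : subcube n k → cube n}
    (hg : ∀ s : subcube n k,
      (s : Fin n → ℝ) ∈ intrinsicFrontier ℝ (subcube n k) → (g s : Fin n → ℝ) = s)
    {x : Fin n → ℝ} {i : Fin n} (hi : (i : ℕ) + 1 ≤ k) (hx : x i = -1 ∨ x i = 1) :
    (g (toSubcube n k x) : Fin n → ℝ) i = x i := by
  have hval : (toSubcube n k x : Fin n → ℝ) i = x i := by
    rcases hx with h | h <;> simp [toSubcube, h, Nat.lt_of_succ_le hi]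
  rw [hg _ (mem_intrinsicFrontier_subcube (toSubcube n k x).2 hi ?_), hval]
  rw [hval]
  rcases hx with h | h <;> simp [h]

lemma map_toCoSubcube_apply {n l : ℕ} {h : coSubcube n l → cube n}
    (hh : ∀ t : coSubcube n l,
      (t : Fin n → ℝ) ∈ intrinsicFrontier ℝ (coSubcube n l) → (h t : Fin n → ℝ) = t)
    {x : Fin n → ℝ} {i : Fin n} (hi : l ≤ (i : ℕ) + 1) (hx : x i = -1 ∨ x i = 1) :
    (h (toCoSubcube n l x) : Fin n → ℝ) i = x i := by
  have hval : (toCoSubcube n l x : Fin n → ℝ) i = x i := by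
    rcases hx with h | h <;> simp [toCoSubcube, hi, h]
  rw [hh _ (mem_intrinsicFrontier_coSubcube (toCoSubcube n l x).2 hi ?_), hval]
  rw [hval]
  rcases hx with h | h <;> simp [h]

theorem mainTheorem4 (n k : ℕ) (hk : k ≤ n)
    (g : subcube n k → cube n) (h : coSubcube n (k + 1) → cube n)
    (hg : Continuous g) (hh : Continuous h)
    (hg_id : ∀ s : subcube n k,
      (s : Fin n → ℝ) ∈ intrinsicFrontier ℝ (subcube n k) → (g s : Fin n → ℝ) = s)
    (hh_id : ∀ t : coSubcube n (k + 1),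
      (t : Fin n → ℝ) ∈ intrinsicFrontier ℝ (coSubcube n (k + 1)) → (h t : Fin n → ℝ) = t) :
    (∃ (s : subcube n k) (t : coSubcube n (k + 1)), g s = h t) ∧
      (Set.range g ∩ Set.range h).Nonempty := by
  have main : ∃ (s : subcube n k) (t : coSubcube n (k + 1)), g s = h t := by
    let u : (Fin n → ℝ) → Fin n → ℝ := fun x => g (toSubcube n k x)
    let v : (Fin n → ℝ) → Fin n → ℝ := fun x => h (toCoSubcube n (k + 1) x)
    have hu : Continuous u := continuous_subtype_val.comp (hg.comp (continuous_toSubcube n k))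
    have hv : Continuous v :=
      continuous_subtype_val.comp (hh.comp (continuous_toCoSubcube n (k + 1)))
    have hub : ∀ x i, |u x i| ≤ 1 := fun x => (g (toSubcube n k x)).2
    have hvb : ∀ x i, |v x i| ≤ 1 := fun x => (h (toCoSubcube n (k + 1) x)).2
    let G : (Fin n → ℝ) → Fin n → ℝ := fun x i =>
      if (i : ℕ) + 1 ≤ k then u x i - v x i else v x i - u x i
    have hG : Continuous G := by
      refine continuous_pi fun i => ?_
      simp only [G]
      split_ifs <;> fun_prop
    obtain ⟨x, -, hx⟩ := exists_eq_zero_of_forall_face (G := G) hG.continuousOn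
      (fun x _ i hxi => by
        have h1 := abs_le.1 (hub x i)
        have h2 := abs_le.1 (hvb x i)
        simp only [G]
        split_ifs with hi
        · have : u x i = x i := map_toSubcube_apply hg_id hi (Or.inl hxi)
          linarith
        · have : v x i = x i := map_toCoSubcube_apply hh_id (by omega) (Or.inl hxi)
          linarith)
      (fun x _ i hxi => by
        have h1 := abs_le.1 (hub x i)
        have h2 := abs_le.1 (hvb x i)
        simp only [G]
        split_ifs with hi
        · have : u x i = x i := map_toSubcube_apply hg_id hi (Or.inr hxi)
          linarith
        · have : v x i = x i := map_toCoSubcube_apply hh_id (by omega) (Or.inr hxi)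
          linarith)
    refine ⟨toSubcube n k x, toCoSubcube n (k + 1) x, Subtype.ext (funext fun i => ?_)⟩
    have hi := congrFun hx i
    simp only [G, Pi.zero_apply] at hi
    change u x i = v x i
    split_ifs at hi <;> linarith
  obtain ⟨s, t, hst⟩ := main
  exact ⟨⟨s, t, hst⟩, g s, ⟨s, rfl⟩, ⟨t, hst.symm⟩⟩
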